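/- Let $\mathcal X$ be a finite set, let $Q:\mathcal X\times\mathcal X\to[0,\infty)$ be the transition rates of an irreducible continuous-time Markov chain on $\mathcal X$ and let $\pi:\mathcal X\to(0,1]$, $\sum_x\pi(x)=1$, satisfy the detailed balance condition $\pi(x)Q(x,y)=\pi(y)Q(y,x)$ for all $x,y$ (so $\pi$ is the stationary distribution). Put $$\mathcal P(\mathcal X)=\Big\{\rho:\mathcal X\to[0,\infty)\ :\ \sum_{x}\rho(x)\pi(x)=1\Big\},\qquad (\operatorname{div} m)(x)=\tfrac12\sum_{y}\big(m(y,x)-m(x,y)\big)Q(x,y)\quad(m\in\mathbb R^{\mathcal X\times\mathcal X}).$$ Let $\theta:[0,\infty)^2\to[0,\infty)$ be an admissible mean: $\theta$ is concave, lower semicontinuous, $1$-homogeneous and symmetric, and it is positive and $C^2$ on $(0,\infty)^2$ (for example the logarithmic or the geometric mean). For $\rho_A,\rho_B\in\mathcal P(\mathcal X)$ let $\mathcal{CE}(\rho_A,\rho_B)$ be the set of pairs $(\rho,m)$ of a curve $\rho:[0,1]\to\mathcal P(\mathcal X)$ and an integrable $m:[0,1]\to\mathbb R^{\mathcal X\times\mathcal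 X}$ with $\rho(0)=\rho_A$, $\rho(1)=\rho_B$ and $\partial_t\rho+\operatorname{div}m=0$ in the integrated sense $\rho(t)=\rho(0)-\int_0^t\operatorname{div}m(s)\,ds$ for all $t\in[0,1]$. Define $$\mathcal A(\rho,m)=\frac12\int_0^1\sum_{x,y\in\mathcal X}\frac{m(t,x,y)^2}{\theta(\rho(t,x),\rho(t,y))}\,Q(x,y)\pi(x)\,dt\in[0,\infty],$$ with $0/0=0$, $a/0=\infty$ for $a>0$ and $\infty\cdot0=0$, and $$\mathcal W(\rho_A,\rho_B)=\inf\big\{\sqrt{\mathcal A(\rho,m)}:(\rho,m)\in\mathcal{CE}(\rho_A,\rho_B)\big\}.$$ Then $\mathcal W(\rho_A,\rho_B)<\infty$ for all $\rho_A,\rho_B\in\mathcal P(\mathcal X)$. Moreover, let $\nu_1,\dots,\nu_p\in\mathcal P(\mathcal X)$, let $\lambda_1,\dots,\lambda_p\ge0$ with $\sum_i\lambda_i=1$, and let $\mathcal J:\mathcal P(\mathcal X)\to\mathbb R$, $$\mathcal J[\nu]=\sum_{i=1}^p\frac{\lambda_i}{2}\,\mathcal W^2(\nu,\nu_i).$$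 Then there exists $\nu^*\in\mathcal P(\mathcal X)$ with $\mathcal J[\nu^*]\le\mathcal J[\nu]$ for all $\nu\in\mathcal P(\mathcal X)$. -/

import Mathlib

open MeasureTheory
open scoped ENNReal

namespace DiscreteTransport

/-- An irreducible, reversible, continuous-time Markov chain on a finite set `X`: transition rates
`Q` and a probability vector `π` satisfying detailed balance. Detailed balance, normalisation and
irreducibility make `π` the unique stationary distribution. -/
structure ReversibleChain (X : Type*) [Fintype X] where
  /-- The transition rates. -/
  Q : X → X → ℝ
  /-- The stationary distribution. -/
  π : X → ℝ
  Q_nonneg : ∀ x y, 0 ≤ Q x y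
  π_pos : ∀ x, 0 < π x
  π_sum : ∑ x, π x = 1
  detailed_balance : ∀ x y, π x * Q x y = π y * Q y x
  /-- Every state can be reached from every other one along transitions of positive rate. -/
  irreducible : ∀ x y, Relation.ReflTransGen (fun a b => 0 < Q a b) x y

/-- An admissible mean `θ : [0, ∞)² → [0, ∞)`. Only the values of `θ` on the closed quadrant
matter. The normalisation `θ s s = s` is not required. -/
structure IsAdmissibleMean (θ : ℝ → ℝ → ℝ) : Prop where
  nonneg : ∀ s t, 0 ≤ s → 0 ≤ t → 0 ≤ θ s t
  pos : ∀ s t, 0 < s → 0 < t → 0 < θ s t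
  concave : ConcaveOn ℝ (Set.Ici (0 : ℝ) ×ˢ Set.Ici (0 : ℝ)) (fun q : ℝ × ℝ => θ q.1 q.2)
  lowerSemicontinuous :
    LowerSemicontinuousOn (fun q : ℝ × ℝ => θ q.1 q.2) (Set.Ici (0 : ℝ) ×ˢ Set.Ici (0 : ℝ))
  homogeneous : ∀ c s t, 0 ≤ c → 0 ≤ s → 0 ≤ t → θ (c * s) (c * t) = c * θ s t
  symm : ∀ s t, 0 ≤ s → 0 ≤ t → θ s t = θ t s
  contDiff :
    ContDiffOn ℝ 2 (fun q : ℝ × ℝ => θ q.1 q.2) (Set.Ioi (0 : ℝ) ×ˢ Set.Ioi (0 : ℝ))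

namespace ReversibleChain

variable {X : Type*} [Fintype X] (C : ReversibleChain X)

/-- The probability densities with respect to `π`. -/
def P : Set (X → ℝ) :=
  {ρ | (∀ x, 0 ≤ ρ x) ∧ ∑ x, ρ x * C.π x = 1}

/-- The graph divergence of a vector field on the edges. -/
noncomputable def div (m : X → X → ℝ) (x : X) : ℝ :=
  (1 / 2) * ∑ y, (m y x - m x y) * C.Q x y

/-- Solutions `(ρ, m)` on `[0, 1]` of the discrete continuity equation `∂ₜρ + div m = 0` joining
`ρA` to `ρB`: the curve `ρ` takes values in the probability densities, the momentum `m` is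
integrable in time, and the equation holds in integrated form (that is, `ρ` is absolutely
continuous and the equation holds for almost every `t`). -/
def CE (ρA ρB : X → ℝ) : Set ((ℝ → X → ℝ) × (ℝ → X → X → ℝ)) :=
  {c | (∀ t ∈ Set.Icc (0 : ℝ) 1, c.1 t ∈ C.P) ∧
    (∀ x y, IntervalIntegrable (fun t => c.2 t x y) volume 0 1) ∧
    (∀ t ∈ Set.Icc (0 : ℝ) 1, ∀ x, c.1 t x = c.1 0 x - ∫ s in (0 : ℝ)..t, C.div (c.2 s) x) ∧
    c.1 0 = ρA ∧ c.1 1 = ρB}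

/-- The action `(1/2) ∫₀¹ ∑_{x,y} m(t,x,y)² / θ(ρ(t,x), ρ(t,y)) Q(x,y) π(x) dt`, with values in
`[0, ∞]`. In `ℝ≥0∞` one has `0 / 0 = 0`, `a / 0 = ∞` for `a > 0` and `∞ * 0 = 0`, which are the
usual conventions here. -/
noncomputable def action (θ : ℝ → ℝ → ℝ) (ρ : ℝ → X → ℝ) (m : ℝ → X → X → ℝ) : ℝ≥0∞ :=
  (1 / 2) * ∫⁻ t in Set.Icc (0 : ℝ) 1, ∑ x, ∑ y,
    ENNReal.ofReal (m t x y ^ 2) / ENNReal.ofReal (θ (ρ t x) (ρ t y)) *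
      ENNReal.ofReal (C.Q x y * C.π x)

/-- The discrete dynamic transport distance, a priori with values in `[0, ∞]`. -/
noncomputable def W (θ : ℝ → ℝ → ℝ) (ρA ρB : X → ℝ) : ℝ≥0∞ :=
  ⨅ c ∈ C.CE ρA ρB, C.action θ c.1 c.2 ^ (1 / 2 : ℝ)

/-- The variance functional `J[μ] = ∑ᵢ (λᵢ / 2) W(μ, νᵢ)²`; real-valued because `W` is finite on
the probability densities. -/
noncomputable def variance (θ : ℝ → ℝ → ℝ) {p : ℕ} (w : Fin p → ℝ) (ν : Fin p → X → ℝ)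
    (μ : X → ℝ) : ℝ :=
  ∑ i, w i / 2 * (C.W θ μ (ν i)).toReal ^ 2

end ReversibleChain

end DiscreteTransport

/-!
A minimiser exists because `J` is continuous on the compact set `𝒫(X)` of densities. Continuity does
not go through semicontinuity of the action (`θ` need not be upper semicontinuous up to the boundary
of the quadrant, so the action need not be lower semicontinuous); it follows from the triangle
inequality for `W` together with an upper bound for `W` near the diagonal.

* `W` is symmetric (`W_symm`, time reversal) and satisfies the triangle inequality (`W_triangle`).
  The latter comes from concatenating a curve run through during `[0, τ]` with one run through
  during `[τ, 1]`, which turns actions `A` and `B` into `A / τ + B / (1 - τ)`, and optimising in `τ`.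
* Concavity and homogeneity give `θ(s, t) ≥ θ(1, 1) min(s, t)` (`IsAdmissibleMean.mul_min_le`), and
  irreducibility gives, for every `f` of mean zero, a flux `v` with `div v = f` and `|v| ≤ K ‖f‖`
  (`exists_div_eq`). If `σ ≥ s > 0`, the curve `ρ + t² (σ - ρ)` with the momentum `2 t v`, where
  `div v = ρ - σ`, stays above `t² s`, so its action density is bounded in time and
  `W(ρ, σ)² ≤ M ‖ρ - σ‖² / s` (`exists_W_sq_le`), even if `ρ` vanishes somewhere.
* Joining two densities through the constant density `1` shows that `W` is finite (`W_ne_top`).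
  Joining `ρ` and `ρ'` with `‖ρ' - ρ‖ ≤ δ` through `(1 - δ) ρ + δ`, which is at least `δ` and at
  distance `O(δ)` from both, shows `W(ρ', ρ) = O(√δ)` (`exists_W_le_sqrt`). By the triangle
  inequality `W(·, μ)` is then continuous (`continuousOn_W`).
-/

namespace DiscreteTransport

/-! ### Bounds on admissible means -/

/-- A concave, `1`-homogeneous and nonnegative mean is bounded below by a multiple of the minimum.
This is the only quantitative information about `θ` that is used. -/
theorem IsAdmissibleMean.mul_min_le {θ : ℝ → ℝ → ℝ} (hθ : IsAdmissibleMean θ) {s t r : ℝ}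
    (hr : 0 ≤ r) (hs : r ≤ s) (ht : r ≤ t) : θ 1 1 * r ≤ θ s t := by
  have hx : ((2 * r, 2 * r) : ℝ × ℝ) ∈ Set.Ici (0 : ℝ) ×ˢ Set.Ici (0 : ℝ) :=
    ⟨by simpa using hr, by simpa using hr⟩
  have hy : ((2 * (s - r), 2 * (t - r)) : ℝ × ℝ) ∈ Set.Ici (0 : ℝ) ×ˢ Set.Ici (0 : ℝ) :=
    ⟨by simpa using hs, by simpa using ht⟩
  have h := hθ.concave.2 hx hy (show (0 : ℝ) ≤ 1 / 2 by norm_num)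
    (show (0 : ℝ) ≤ 1 / 2 by norm_num) (by norm_num)
  simp only [smul_eq_mul, Prod.smul_mk, Prod.mk_add_mk] at h
  have e1 : 1 / 2 * (2 * r) + 1 / 2 * (2 * (s - r)) = s := by ring
  have e2 : 1 / 2 * (2 * r) + 1 / 2 * (2 * (t - r)) = t := by ring
  have h1 := hθ.homogeneous (2 * r) 1 1 (by linarith) (by norm_num) (by norm_num)
  have h2 := hθ.nonneg (2 * (s - r)) (2 * (t - r)) (by linarith) (by linarith)
  rw [e1, e2] at h
  rw [mul_one] at h1
  rw [h1] at h
  nlinarith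

namespace ReversibleChain

variable {X : Type*} [Fintype X] (C : ReversibleChain X)

/-! ### Solving the divergence equation -/

theorem div_add (m n : X → X → ℝ) (x : X) :
    C.div (fun a b => m a b + n a b) x = C.div m x + C.div n x := by
  simp only [div, ← mul_add, ← Finset.sum_add_distrib]
  congr 1
  exact Finset.sum_congr rfl fun y _ => by ring

theorem div_const_mul (c : ℝ) (m : X → X → ℝ) (x : X) :
    C.div (fun a b => c * m a b) x = c * C.div m x := by
  simp only [div, Finset.mul_sum]
  exact Finset.sum_congr rfl fun y _ => by ring

theorem div_neg (m : X → X → ℝ) (x : X) :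
    C.div (fun a b => -m a b) x = -C.div m x := by
  simpa using C.div_const_mul (-1) m x

theorem div_sum {ι : Type*} (s : Finset ι) (m : ι → X → X → ℝ) (x : X) :
    C.div (fun a b => ∑ i ∈ s, m i a b) x = ∑ i ∈ s, C.div (m i) x := by
  classical
  induction s using Finset.induction_on with
  | empty => simp [div]
  | insert i s hi ih => simp only [Finset.sum_insert hi, div_add, ih]

/-- Unit mass can be transported between any two states: the flux is built by adding one edge at a
time along a path of transitions of positive rate. -/
theorem exists_div_eq_dirac_sub [DecidableEq X] (x y : X) :
    ∃ m : X → X → ℝ, ∀ z, C.div m z =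
      (if z = x then (C.π x)⁻¹ else 0) - (if z = y then (C.π y)⁻¹ else 0) := by
  induction C.irreducible x y with
  | refl => exact ⟨fun _ _ => 0, fun z => by simp [div]⟩
  | @tail b c _ hbc ih =>
    obtain ⟨m, hm⟩ := ih
    have hpb := C.π_pos b
    have hpc := C.π_pos c
    have hdb := C.detailed_balance b c
    let n : X → X → ℝ := fun u v =>
      if u = b then if v = c then -2 / (C.π b * C.Q b c) else 0 else 0
    have hn : ∀ z, C.div n z =
        (if z = b then (C.π b)⁻¹ else 0) - (if z = c then (C.π c)⁻¹ else 0) := by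
      intro z
      have hin : ∑ w, n w z * C.Q z w =
          if z = c then -2 / (C.π b * C.Q b c) * C.Q z b else 0 := by
        simp [n]
      have hout : ∑ w, n z w * C.Q z w =
          if z = b then -2 / (C.π b * C.Q b c) * C.Q z c else 0 := by
        by_cases hz : z = b <;> simp [n, hz]
      have hdiv : C.div n z = 1 / 2 * (∑ w, n w z * C.Q z w - ∑ w, n z w * C.Q z w) := by
        simp only [div, sub_mul, Finset.sum_sub_distrib]
      have eb : -2 / (C.π b * C.Q b c) * C.Q b c = -2 * (C.π b)⁻¹ := by
        field_simp
      have ec : -2 / (C.π b * C.Q b c) * C.Q c b = -2 * (C.π c)⁻¹ := by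
        have : C.Q c b = C.π b * C.Q b c / C.π c := by
          rw [hdb]; field_simp
        rw [this]; field_simp
      rw [hdiv, hin, hout]
      by_cases h1 : z = b <;> by_cases h2 : z = c
      · rw [if_pos h1, if_pos h2, if_pos h1, if_pos h2, ← h1, ← h2]; ring
      · rw [if_pos h1, if_neg h2, if_pos h1, if_neg h2, h1, eb]; ring
      · rw [if_neg h1, if_pos h2, if_neg h1, if_pos h2, h2, ec]; ring
      · rw [if_neg h1, if_neg h2, if_neg h1, if_neg h2]; ring
    exact ⟨fun u v => m u v + n u v, fun z => by rw [div_add, hm, hn]; ring⟩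

theorem nonempty (C : ReversibleChain X) : Nonempty X := by
  by_contra h
  rw [not_nonempty_iff] at h
  simpa using C.π_sum

/-- The divergence has a bounded right inverse on the functions of mean zero. -/
theorem exists_div_eq : ∃ K : ℝ, 0 ≤ K ∧ ∀ f : X → ℝ, ∑ x, f x * C.π x = 0 →
    ∃ v : X → X → ℝ, (∀ x, C.div v x = f x) ∧ ∀ x y, |v x y| ≤ K * ‖f‖ := by
  classical
  obtain ⟨x₀⟩ := C.nonempty
  choose m hm using fun x => C.exists_div_eq_dirac_sub x x₀
  refine ⟨∑ z, C.π z * ∑ a, ∑ b, |m z a b|, ?_, fun f hf => ?_⟩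
  · exact Finset.sum_nonneg fun z _ => mul_nonneg (C.π_pos z).le
      (Finset.sum_nonneg fun a _ => Finset.sum_nonneg fun b _ => abs_nonneg _)
  refine ⟨fun a b => ∑ z, f z * C.π z * m z a b, fun x => ?_, fun a b => ?_⟩
  · have hx := (C.π_pos x).ne'
    rw [div_sum]
    simp only [div_const_mul, hm, mul_sub, Finset.sum_sub_distrib, ← Finset.sum_mul, hf,
      zero_mul, sub_zero]
    simp [mul_assoc, hx]
  · calc |∑ z, f z * C.π z * m z a b| ≤ ∑ z, |f z * C.π z * m z a b| :=
          Finset.abs_sum_le_sum_abs _ _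
      _ ≤ ∑ z, (C.π z * ∑ a, ∑ b, |m z a b|) * ‖f‖ := by
          refine Finset.sum_le_sum fun z _ => ?_
          have h1 : |m z a b| ≤ ∑ a, ∑ b, |m z a b| :=
            (Finset.single_le_sum (f := fun b => |m z a b|) (fun _ _ => abs_nonneg _)
              (Finset.mem_univ b)).trans
            (Finset.single_le_sum (f := fun a => ∑ b, |m z a b|)
              (fun _ _ => Finset.sum_nonneg fun _ _ => abs_nonneg _) (Finset.mem_univ a))
          have h2 : |f z| ≤ ‖f‖ := norm_le_pi_norm f z
          rw [abs_mul, abs_mul, abs_of_pos (C.π_pos z), mul_comm |f z|, mul_assoc, mul_assoc,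
            mul_comm |f z|]
          have := (C.π_pos z).le
          gcongr
      _ = _ := by rw [Finset.sum_mul]

/-! ### The action density -/

/-- The integrand of the action (without the factor `1/2`), as a function of a density and a
momentum at a fixed time. -/
noncomputable def actionDensity (θ : ℝ → ℝ → ℝ) (r : X → ℝ) (m : X → X → ℝ) : ℝ≥0∞ :=
  ∑ x, ∑ y, ENNReal.ofReal (m x y ^ 2) / ENNReal.ofReal (θ (r x) (r y)) *
    ENNReal.ofReal (C.Q x y * C.π x)

theorem action_eq (θ : ℝ → ℝ → ℝ) (ρ : ℝ → X → ℝ) (m : ℝ → X → X → ℝ) :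
    C.action θ ρ m = (1 / 2) * ∫⁻ t in Set.Icc (0 : ℝ) 1, C.actionDensity θ (ρ t) (m t) := rfl

theorem actionDensity_const_mul (θ : ℝ → ℝ → ℝ) (r : X → ℝ) (c : ℝ) (m : X → X → ℝ) :
    C.actionDensity θ r (fun x y => c * m x y) =
      ENNReal.ofReal (c ^ 2) * C.actionDensity θ r m := by
  simp only [actionDensity, Finset.mul_sum]
  refine Finset.sum_congr rfl fun x _ => Finset.sum_congr rfl fun y _ => ?_
  rw [mul_pow, ENNReal.ofReal_mul (sq_nonneg c), mul_div_assoc, mul_assoc]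

theorem actionDensity_neg (θ : ℝ → ℝ → ℝ) (r : X → ℝ) (m : X → X → ℝ) :
    C.actionDensity θ r (fun x y => -m x y) = C.actionDensity θ r m := by
  simp only [actionDensity, neg_sq]

/-! ### Operations on solutions of the continuity equation -/

theorem intervalIntegrable_div {m : ℝ → X → X → ℝ} {a b : ℝ}
    (hm : ∀ x y, IntervalIntegrable (fun t => m t x y) volume a b) (x : X) :
    IntervalIntegrable (fun t => C.div (m t) x) volume a b := by
  simp only [div]
  refine IntervalIntegrable.const_mul ?_ _
  have := IntervalIntegrable.sum (μ := volume) (a := a) (b := b) Finset.univ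
    (f := fun y t => (m t y x - m t x y) * C.Q x y)
    (fun y _ => ((hm y x).sub (hm x y)).mul_const _)
  simpa [Finset.sum_fn] using this

/-- Time reversal, `t ↦ (ρ(1 - t), -m(1 - t))`. -/
theorem reverse_mem_CE {a b : X → ℝ} {c : (ℝ → X → ℝ) × (ℝ → X → X → ℝ)} (hc : c ∈ C.CE a b) :
    (fun t => c.1 (1 - t), fun t x y => -c.2 (1 - t) x y) ∈ C.CE b a := by
  obtain ⟨hP, hI, hE, h0, h1⟩ := hc
  refine ⟨fun t ht => hP _ ⟨by linarith [ht.2], by linarith [ht.1]⟩, fun x y => ?_,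
    fun t ht x => ?_, by simpa using h1, by simpa using h0⟩
  · have := ((hI x y).comp_sub_left 1).neg.symm
    simp only [sub_zero, sub_self] at this
    exact this
  · have hd := C.intervalIntegrable_div hI x
    have e1 := hE 1 (by simp) x
    have e2 := hE (1 - t) ⟨by linarith [ht.2], by linarith [ht.1]⟩ x
    have e3 : ∫ s in (0 : ℝ)..t, C.div (fun x y => -c.2 (1 - s) x y) x =
        -∫ s in (1 - t)..1, C.div (c.2 s) x := by
      simp only [div_neg, intervalIntegral.integral_neg]
      rw [intervalIntegral.integral_comp_sub_left (fun s => C.div (c.2 s) x) 1, sub_zero]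
    have e4 := intervalIntegral.integral_add_adjacent_intervals
      (a := (0 : ℝ)) (b := 1 - t) (c := 1) (μ := volume) (f := fun s => C.div (c.2 s) x)
      (hd.mono_set (by
        rw [Set.uIcc_of_le (by linarith [ht.2]), Set.uIcc_of_le zero_le_one]
        exact Set.Icc_subset_Icc_right (by linarith [ht.1])))
      (hd.mono_set (by
        rw [Set.uIcc_of_le (by linarith [ht.1]), Set.uIcc_of_le zero_le_one]
        exact Set.Icc_subset_Icc_left (by linarith [ht.2])))
    simp only [sub_zero]
    rw [e3, e1, e2, ← e4]
    ring

theorem action_reverse (θ : ℝ → ℝ → ℝ) (c : (ℝ → X → ℝ) × (ℝ → X → X → ℝ)) :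
    C.action θ (fun t => c.1 (1 - t)) (fun t x y => -c.2 (1 - t) x y) =
      C.action θ c.1 c.2 := by
  simp only [action_eq, actionDensity_neg]
  congr 1
  have h := lintegral_image_eq_lintegral_abs_deriv_mul (s := Set.Icc (0 : ℝ) 1)
    (f := fun t => 1 - t) (f' := fun _ => -1) measurableSet_Icc
    (fun x _ => ((hasDerivAt_id x).const_sub 1).hasDerivWithinAt)
    (fun x _ y _ h => by simpa using h) (fun t => C.actionDensity θ (c.1 t) (c.2 t))
  rw [Set.image_const_sub_Icc] at h
  simpa using h.symm

/-- The momentum of the concatenation of two curves, the first one run through during `[0, τ]` and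
the second one during `[τ, 1]`. The `t - 0` puts both branches into the form `(t - a) / k` of the
rescaling lemmas. -/
noncomputable def concatMomentum (τ : ℝ) (m n : ℝ → X → X → ℝ) : ℝ → X → X → ℝ := fun t =>
  if t ≤ τ then fun x y => τ⁻¹ * m ((t - 0) / τ) x y
  else fun x y => (1 - τ)⁻¹ * n ((t - τ) / (1 - τ)) x y

/-- The concatenation of two curves of densities, the first one run through during `[0, τ]` and
the second one during `[τ, 1]`. -/
noncomputable def concatCurve (τ : ℝ) (ρ σ : ℝ → X → ℝ) : ℝ → X → ℝ := fun t =>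
  if t ≤ τ then ρ ((t - 0) / τ) else σ ((t - τ) / (1 - τ))

theorem _root_.IntervalIntegrable.rescale {f : ℝ → ℝ} (k a : ℝ)
    (hf : IntervalIntegrable f volume 0 1) :
    IntervalIntegrable (fun t => k⁻¹ * f ((t - a) / k)) volume a (a + k) := by
  have h := ((hf.comp_mul_left (c := k⁻¹)).comp_sub_right a).const_mul k⁻¹
  have e : (1 : ℝ) / k⁻¹ + a = a + k := by rw [one_div, inv_inv, add_comm]
  rw [zero_div, zero_add, e] at h
  refine h.congr fun t _ => ?_
  simp [div_eq_inv_mul]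

theorem integral_rescale (f : ℝ → ℝ) {k : ℝ} (a t : ℝ) :
    ∫ s in a..t, k⁻¹ * f ((s - a) / k) = ∫ s in (0 : ℝ)..(t - a) / k, f s := by
  have h := intervalIntegral.integral_comp_sub_right (a := a) (b := t)
    (fun s => k⁻¹ * f (s / k)) a
  rw [h, intervalIntegral.integral_const_mul, ← smul_eq_mul,
    intervalIntegral.inv_smul_integral_comp_div, sub_self, zero_div]

theorem concat_mem_CE {τ : ℝ} (h0 : 0 < τ) (h1 : τ < 1) {a b d : X → ℝ}
    {c e : (ℝ → X → ℝ) × (ℝ → X → X → ℝ)} (hc : c ∈ C.CE a b) (he : e ∈ C.CE b d) :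
    (concatCurve τ c.1 e.1, concatMomentum τ c.2 e.2) ∈ C.CE a d := by
  obtain ⟨cP, cI, cE, c0, c1⟩ := hc
  obtain ⟨eP, eI, eE, e0, e1⟩ := he
  have h1' : 0 < 1 - τ := by linarith
  have hfst : ∀ x y, IntervalIntegrable
      (fun t => concatMomentum τ c.2 e.2 t x y) volume 0 τ := fun x y => by
    have h := (cI x y).rescale τ 0
    rw [zero_add] at h
    refine h.congr fun t ht => ?_
    rw [Set.uIoc_of_le h0.le] at ht
    simp only [concatMomentum, if_pos ht.2]
  have hsnd : ∀ x y, IntervalIntegrable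
      (fun t => concatMomentum τ c.2 e.2 t x y) volume τ 1 := fun x y => by
    have h := (eI x y).rescale (1 - τ) τ
    rw [add_sub_cancel] at h
    refine h.congr fun t ht => ?_
    rw [Set.uIoc_of_le h1.le] at ht
    simp only [concatMomentum, if_neg (not_le.2 ht.1)]
  have int1 : ∀ x, ∀ t ∈ Set.Icc (0 : ℝ) τ,
      ∫ s in (0 : ℝ)..t, C.div (concatMomentum τ c.2 e.2 s) x =
        ∫ s in (0 : ℝ)..t / τ, C.div (c.2 s) x := fun x t ht => by
    have h := integral_rescale (fun s => C.div (c.2 s) x) (k := τ) 0 t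
    rw [sub_zero] at h
    rw [← h]
    refine intervalIntegral.integral_congr fun s hs => ?_
    rw [Set.uIcc_of_le ht.1] at hs
    have hs' : s ≤ τ := hs.2.trans ht.2
    simp only [concatMomentum, if_pos hs', div_const_mul]
  have int2 : ∀ x, ∀ t, τ ≤ t →
      ∫ s in τ..t, C.div (concatMomentum τ c.2 e.2 s) x =
        ∫ s in (0 : ℝ)..(t - τ) / (1 - τ), C.div (e.2 s) x := fun x t ht => by
    rw [← integral_rescale (fun s => C.div (e.2 s) x) (k := 1 - τ) τ t]
    refine intervalIntegral.integral_congr_uIoo fun s hs => ?_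
    rw [Set.uIoo_of_le ht] at hs
    simp only [concatMomentum, if_neg (not_le.2 hs.1), div_const_mul]
  refine ⟨fun t ht => ?_, fun x y => (hfst x y).trans (hsnd x y), fun t ht x => ?_, ?_, ?_⟩
  · by_cases h : t ≤ τ
    · simp only [concatCurve, if_pos h, sub_zero]
      exact cP _ ⟨div_nonneg ht.1 h0.le, (div_le_one h0).2 h⟩
    · simp only [concatCurve, if_neg h]
      push Not at h
      exact eP _ ⟨div_nonneg (by linarith) h1'.le, (div_le_one h1').2 (by linarith [ht.2])⟩
  · have hz : concatCurve τ c.1 e.1 0 = c.1 0 := by simp [concatCurve, h0.le]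
    change concatCurve τ c.1 e.1 t x = concatCurve τ c.1 e.1 0 x -
      ∫ s in (0 : ℝ)..t, C.div (concatMomentum τ c.2 e.2 s) x
    rw [hz]
    by_cases h : t ≤ τ
    · rw [int1 x t ⟨ht.1, h⟩]
      simp only [concatCurve, if_pos h, sub_zero]
      exact cE _ ⟨div_nonneg ht.1 h0.le, (div_le_one h0).2 h⟩ x
    · simp only [concatCurve, if_neg h]
      push Not at h
      have hsub : IntervalIntegrable (fun s => C.div (concatMomentum τ c.2 e.2 s) x)
          volume τ t := (C.intervalIntegrable_div hsnd x).mono_set (by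
        rw [Set.uIcc_of_le h.le, Set.uIcc_of_le h1.le]
        exact Set.Icc_subset_Icc_right ht.2)
      rw [← intervalIntegral.integral_add_adjacent_intervals
        (C.intervalIntegrable_div hfst x) hsub, int1 x τ ⟨h0.le, le_rfl⟩, int2 x t h.le,
        div_self h0.ne', eE ((t - τ) / (1 - τ))
          ⟨div_nonneg (by linarith) h1'.le, (div_le_one h1').2 (by linarith [ht.2])⟩ x,
        e0, ← c1, cE 1 (by simp) x]
      ring
  · simp [concatCurve, h0.le, c0]
  · simp [concatCurve, not_le.2 h1, h1'.ne', e1]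

theorem lintegral_rescale (g : ℝ → ℝ≥0∞) {k : ℝ} (hk : 0 < k) (a : ℝ) :
    ∫⁻ t in Set.Icc a (a + k), ENNReal.ofReal (k⁻¹ ^ 2) * g ((t - a) / k) =
      ENNReal.ofReal k⁻¹ * ∫⁻ t in Set.Icc (0 : ℝ) 1, g t := by
  have h := lintegral_image_eq_lintegral_abs_deriv_mul (s := Set.Icc a (a + k))
    (f := fun t => (t - a) / k) (f' := fun _ => 1 / k) measurableSet_Icc
    (fun x _ => (((hasDerivAt_id x).sub_const a).div_const k).hasDerivWithinAt)
    (fun x _ y _ h => by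
      have := (div_left_inj' hk.ne').1 h
      linarith) g
  have himg : (fun t => (t - a) / k) '' Set.Icc a (a + k) = Set.Icc 0 1 := by
    ext u
    constructor
    · rintro ⟨t, ht, rfl⟩
      exact ⟨div_nonneg (by linarith [ht.1]) hk.le, (div_le_one hk).2 (by linarith [ht.2])⟩
    · intro hu
      exact ⟨a + k * u, ⟨by nlinarith [hu.1], by nlinarith [hu.2]⟩, by field_simp; ring⟩
  rw [himg] at h
  rw [h, ← lintegral_const_mul' _ _ ENNReal.ofReal_ne_top]
  congr 1
  ext t
  rw [one_div, abs_of_pos (inv_pos.2 hk), ← mul_assoc, ← ENNReal.ofReal_mul (by positivity), sq]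

theorem action_concat_le (θ : ℝ → ℝ → ℝ) {τ : ℝ} (h0 : 0 < τ) (h1 : τ < 1)
    (c e : (ℝ → X → ℝ) × (ℝ → X → X → ℝ)) :
    C.action θ (concatCurve τ c.1 e.1) (concatMomentum τ c.2 e.2) ≤
      ENNReal.ofReal τ⁻¹ * C.action θ c.1 c.2 +
        ENNReal.ofReal (1 - τ)⁻¹ * C.action θ e.1 e.2 := by
  simp only [action_eq]
  rw [mul_left_comm, mul_left_comm (ENNReal.ofReal (1 - τ)⁻¹), ← mul_add]
  gcongr
  rw [← lintegral_rescale _ h0 0, ← lintegral_rescale _ (sub_pos.2 h1) τ, zero_add,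
    add_sub_cancel, ← Set.Icc_union_Ioc_eq_Icc h0.le h1.le]
  refine (lintegral_union_le _ _ _).trans (add_le_add (le_of_eq ?_) ?_)
  · refine setLIntegral_congr_fun measurableSet_Icc fun t ht => ?_
    simp only [concatCurve, concatMomentum, if_pos ht.2, actionDensity_const_mul]
  · refine le_trans (le_of_eq ?_) (lintegral_mono_set Set.Ioc_subset_Icc_self)
    refine setLIntegral_congr_fun measurableSet_Ioc fun t ht => ?_
    simp only [concatCurve, concatMomentum, if_neg (not_le.2 ht.1), actionDensity_const_mul]

/-! ### The transport distance is a pseudometric -/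

theorem W_sq (θ : ℝ → ℝ → ℝ) (a b : X → ℝ) :
    C.W θ a b ^ 2 = ⨅ c : C.CE a b, C.action θ c.1.1 c.1.2 := by
  have h := (ENNReal.orderIsoRpow (1 / 2) (by norm_num)).map_iInf
    (fun c : C.CE a b => C.action θ c.1.1 c.1.2)
  simp only [ENNReal.orderIsoRpow_apply] at h
  rw [W, iInf_subtype', ← h, ← ENNReal.rpow_natCast, ← ENNReal.rpow_mul]
  norm_num

theorem W_symm (θ : ℝ → ℝ → ℝ) (a b : X → ℝ) : C.W θ a b = C.W θ b a := by
  have key : ∀ a b : X → ℝ, C.W θ a b ≤ C.W θ b a := by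
    intro a b
    unfold W
    refine le_iInf₂ fun c hc => ?_
    rw [← C.action_reverse θ c]
    exact iInf₂_le_of_le _ (C.reverse_mem_CE hc) le_rfl
  exact le_antisymm (key a b) (key b a)

/-- The triangle inequality in the form given by concatenation at the time `τ`. Optimising in `τ`
yields the usual one. -/
theorem W_sq_le_add (θ : ℝ → ℝ → ℝ) {τ : ℝ} (h0 : 0 < τ) (h1 : τ < 1) (a b d : X → ℝ) :
    C.W θ a d ^ 2 ≤ ENNReal.ofReal τ⁻¹ * C.W θ a b ^ 2 +
      ENNReal.ofReal (1 - τ)⁻¹ * C.W θ b d ^ 2 := by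
  have h1' : 0 < 1 - τ := sub_pos.2 h1
  simp only [W_sq]
  rw [ENNReal.mul_iInf_of_ne (by simpa using h0) ENNReal.ofReal_ne_top,
    ENNReal.mul_iInf_of_ne (by simpa using h1) ENNReal.ofReal_ne_top, ENNReal.iInf_add]
  refine le_iInf fun c => ?_
  rw [ENNReal.add_iInf]
  refine le_iInf fun e => ?_
  exact (iInf_le (fun c : C.CE a d => C.action θ c.1.1 c.1.2)
    ⟨_, C.concat_mem_CE h0 h1 c.2 e.2⟩).trans (C.action_concat_le θ h0 h1 c.1 e.1)

theorem W_triangle (θ : ℝ → ℝ → ℝ) {a b d : X → ℝ} (hab : C.W θ a b ≠ ⊤) (hbd : C.W θ b d ≠ ⊤) :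
    (C.W θ a d).toReal ≤ (C.W θ a b).toReal + (C.W θ b d).toReal := by
  set x := (C.W θ a b).toReal
  set y := (C.W θ b d).toReal
  have hx : 0 ≤ x := ENNReal.toReal_nonneg
  have hy : 0 ≤ y := ENNReal.toReal_nonneg
  refine le_of_forall_pos_le_add fun ε hε => ?_
  -- The optimal `τ` is `x / (x + y)`; adding `ε / 2` to both terms keeps it inside `(0, 1)`.
  set u := x + ε / 2
  set v := y + ε / 2
  have hu : 0 < u := by positivity
  have hv : 0 < v := by positivity
  have hτ : 1 - u / (u + v) = v / (u + v) := by field_simp; simp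
  have h := C.W_sq_le_add θ (τ := u / (u + v)) (by positivity)
    ((div_lt_one (by positivity)).2 (by linarith)) a b d
  have hr := ENNReal.toReal_mono (by finiteness) h
  rw [ENNReal.toReal_add (by finiteness) (by finiteness), ENNReal.toReal_mul,
    ENNReal.toReal_mul, hτ, inv_div, inv_div, ENNReal.toReal_ofReal (by positivity),
    ENNReal.toReal_ofReal (by positivity), ENNReal.toReal_pow, ENNReal.toReal_pow,
    ENNReal.toReal_pow] at hr
  have hxu : (u + v) / u * x ^ 2 ≤ (u + v) / u * u ^ 2 := by
    have : x ≤ u := by simp only [u]; linarith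
    gcongr
  have hyv : (u + v) / v * y ^ 2 ≤ (u + v) / v * v ^ 2 := by
    have : y ≤ v := by simp only [v]; linarith
    gcongr
  have hsum : (u + v) / u * u ^ 2 + (u + v) / v * v ^ 2 = (u + v) ^ 2 := by
    field_simp
  have hfin : (C.W θ a d).toReal ≤ u + v :=
    le_of_sq_le_sq (by linarith) (by positivity)
  simp only [u, v] at hfin
  linarith

/-! ### Upper bounds for the distance -/

theorem convexCombo_mem_P {ρ σ : X → ℝ} (hρ : ρ ∈ C.P) (hσ : σ ∈ C.P) {u : ℝ} (h0 : 0 ≤ u)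
    (h1 : u ≤ 1) : (fun x => ρ x + u * (σ x - ρ x)) ∈ C.P := by
  refine ⟨fun x => ?_, ?_⟩
  · nlinarith [hρ.1 x, hσ.1 x, mul_nonneg h0 (hσ.1 x), mul_nonneg (sub_nonneg.2 h1) (hρ.1 x)]
  · have : ∀ x, (ρ x + u * (σ x - ρ x)) * C.π x =
        (1 - u) * (ρ x * C.π x) + u * (σ x * C.π x) := fun x => by ring
    simp only [this, Finset.sum_add_distrib, ← Finset.mul_sum, hρ.2, hσ.2]
    ring

theorem quadratic_mem_CE {ρ σ : X → ℝ} (hρ : ρ ∈ C.P) (hσ : σ ∈ C.P) {v : X → X → ℝ}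
    (hv : ∀ x, C.div v x = ρ x - σ x) :
    ((fun t x => ρ x + t ^ 2 * (σ x - ρ x), fun t x y => (2 * t) * v x y) :
      (ℝ → X → ℝ) × (ℝ → X → X → ℝ)) ∈ C.CE ρ σ := by
  refine ⟨fun t ht => C.convexCombo_mem_P hρ hσ (sq_nonneg t) (pow_le_one₀ ht.1 ht.2),
    fun x y => Continuous.intervalIntegrable (by fun_prop) _ _, fun t _ x => ?_,
    by simp, by simp⟩
  have h : ∫ s in (0 : ℝ)..t, 2 * s * (ρ x - σ x) = t ^ 2 * (ρ x - σ x) := by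
    rw [intervalIntegral.integral_mul_const, intervalIntegral.integral_const_mul, integral_id]
    ring
  simp only [div_const_mul, hv]
  rw [h]
  ring

/-- The quadratic time parametrisation makes the action density bounded in time, even where `ρ`
vanishes: both `m²` and the lower bound for `θ` are of order `t²`. -/
theorem exists_W_sq_le {θ : ℝ → ℝ → ℝ} (hθ : IsAdmissibleMean θ) :
    ∃ M : ℝ, 0 ≤ M ∧ ∀ ρ ∈ C.P, ∀ σ ∈ C.P, ∀ s : ℝ, 0 < s → (∀ x, s ≤ σ x) →
      C.W θ ρ σ ^ 2 ≤ ENNReal.ofReal (M * ‖ρ - σ‖ ^ 2 / s) := by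
  obtain ⟨K, hK, hdiv⟩ := C.exists_div_eq
  have hc : 0 < θ 1 1 := hθ.pos 1 1 one_pos one_pos
  have hq : ∀ x y, 0 ≤ C.Q x y * C.π x := fun x y => mul_nonneg (C.Q_nonneg x y) (C.π_pos x).le
  refine ⟨∑ x, ∑ y, 4 * K ^ 2 / θ 1 1 * (C.Q x y * C.π x),
    Finset.sum_nonneg fun x _ => Finset.sum_nonneg fun y _ => mul_nonneg (by positivity) (hq x y),
    fun ρ hρ σ hσ s hs hsσ => ?_⟩
  obtain ⟨v, hv, hvK⟩ := hdiv (ρ - σ) (by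
    simp only [Pi.sub_apply, sub_mul, Finset.sum_sub_distrib, hρ.2, hσ.2, sub_self])
  rw [W_sq]
  refine (iInf_le _ ⟨_, C.quadratic_mem_CE hρ hσ hv⟩).trans ?_
  simp only [action_eq]
  have hbound : ∀ t ∈ Set.Icc (0 : ℝ) 1,
      C.actionDensity θ (fun x => ρ x + t ^ 2 * (σ x - ρ x)) (fun x y => 2 * t * v x y) ≤
      ENNReal.ofReal
        ((∑ x, ∑ y, 4 * K ^ 2 / θ 1 1 * (C.Q x y * C.π x)) * ‖ρ - σ‖ ^ 2 / s) := by
    intro t ht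
    rw [Finset.sum_mul, Finset.sum_div, ENNReal.ofReal_sum_of_nonneg fun x _ =>
      div_nonneg (mul_nonneg (Finset.sum_nonneg fun y _ => mul_nonneg (by positivity) (hq x y))
        (sq_nonneg _)) hs.le]
    refine Finset.sum_le_sum fun x _ => ?_
    rw [Finset.sum_mul, Finset.sum_div, ENNReal.ofReal_sum_of_nonneg fun y _ =>
      div_nonneg (mul_nonneg (mul_nonneg (by positivity) (hq x y)) (sq_nonneg _)) hs.le]
    refine Finset.sum_le_sum fun y _ => ?_
    rcases ht.1.eq_or_lt with rfl | ht0
    -- At `t = 0` the momentum vanishes, and `0 / θ = 0` whatever the value of `θ`.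
    · simp
    have hmin : ∀ z, t ^ 2 * s ≤ ρ z + t ^ 2 * (σ z - ρ z) := fun z => by
      have h1 : t ^ 2 ≤ 1 := pow_le_one₀ ht.1 ht.2
      nlinarith [mul_nonneg (sub_nonneg.2 h1) (hρ.1 z),
        mul_le_mul_of_nonneg_left (hsσ z) (sq_nonneg t)]
    have hθt := hθ.mul_min_le (by positivity) (hmin x) (hmin y)
    have hpos : 0 < θ 1 1 * (t ^ 2 * s) := by positivity
    rw [← ENNReal.ofReal_div_of_pos (hpos.trans_le hθt), ← ENNReal.ofReal_mul
      (div_nonneg (sq_nonneg _) (hpos.trans_le hθt).le)]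
    refine ENNReal.ofReal_le_ofReal ?_
    calc (2 * t * v x y) ^ 2 / θ (ρ x + t ^ 2 * (σ x - ρ x)) (ρ y + t ^ 2 * (σ y - ρ y)) *
          (C.Q x y * C.π x)
        ≤ (4 * t ^ 2 * (K * ‖ρ - σ‖) ^ 2) / (θ 1 1 * (t ^ 2 * s)) * (C.Q x y * C.π x) := by
          refine mul_le_mul_of_nonneg_right (div_le_div₀ (by positivity) ?_ hpos hθt) (hq x y)
          have := sq_le_sq' (abs_le.1 (hvK x y)).1 (abs_le.1 (hvK x y)).2
          nlinarith [mul_le_mul_of_nonneg_left this (sq_nonneg t)]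
      _ = 4 * K ^ 2 / θ 1 1 * (C.Q x y * C.π x) * ‖ρ - σ‖ ^ 2 / s := by
          field_simp
  calc (1 / 2 : ℝ≥0∞) * _ ≤ 1 * _ := by
        gcongr
        exact ENNReal.half_le_self
    _ ≤ _ := by
        rw [one_mul]
        refine (setLIntegral_mono' measurableSet_Icc hbound).trans ?_
        simp

theorem one_mem_P : (fun _ => 1 : X → ℝ) ∈ C.P :=
  ⟨fun _ => zero_le_one, by simpa using C.π_sum⟩

theorem W_ne_top_of_pos {θ : ℝ → ℝ → ℝ} (hθ : IsAdmissibleMean θ) {ρ σ : X → ℝ} (hρ : ρ ∈ C.P)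
    (hσ : σ ∈ C.P) {s : ℝ} (hs : 0 < s) (hsσ : ∀ x, s ≤ σ x) : C.W θ ρ σ ≠ ⊤ := by
  obtain ⟨M, -, hM⟩ := C.exists_W_sq_le hθ
  intro h
  have := hM ρ hρ σ hσ s hs hsσ
  simp [h] at this

theorem W_ne_top {θ : ℝ → ℝ → ℝ} (hθ : IsAdmissibleMean θ) {ρ ρ' : X → ℝ} (hρ : ρ ∈ C.P)
    (hρ' : ρ' ∈ C.P) : C.W θ ρ ρ' ≠ ⊤ := by
  have h1 := C.W_ne_top_of_pos hθ hρ C.one_mem_P one_pos fun _ => le_rfl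
  have h2 := C.W_ne_top_of_pos hθ hρ' C.one_mem_P one_pos fun _ => le_rfl
  rw [W_symm] at h2
  have h := C.W_sq_le_add θ (τ := 1 / 2) (by norm_num) (by norm_num) ρ (fun _ => 1) ρ'
  intro htop
  rw [htop] at h
  have : ENNReal.ofReal (1 / 2 : ℝ)⁻¹ * C.W θ ρ (fun _ => 1) ^ 2 +
      ENNReal.ofReal (1 - 1 / 2 : ℝ)⁻¹ * C.W θ (fun _ => 1) ρ' ^ 2 ≠ ⊤ := by finiteness
  exact this (top_le_iff.1 (by simpa using h))

/-! ### Continuity of the distance and existence of a minimiser -/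

/-- Near `ρ` the distance to `ρ` is at most of the order of the square root of the norm
distance: both densities are joined to `(1 - δ) ρ + δ`, which is bounded below by `δ` and lies within `O(δ)`
of them. -/
theorem exists_W_le_sqrt {θ : ℝ → ℝ → ℝ} (hθ : IsAdmissibleMean θ) {ρ : X → ℝ} (hρ : ρ ∈ C.P) :
    ∃ B : ℝ, 0 ≤ B ∧ ∀ δ : ℝ, 0 < δ → δ ≤ 1 → ∀ ρ' ∈ C.P, ‖ρ' - ρ‖ ≤ δ →
      (C.W θ ρ' ρ).toReal ≤ B * √δ := by
  obtain ⟨M, hM0, hM⟩ := C.exists_W_sq_le hθ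
  set R := 1 + ‖(fun x => ρ x - 1 : X → ℝ)‖
  have hR : 0 ≤ R := by positivity
  refine ⟨2 * (√M * R), by positivity, fun δ hδ hδ1 ρ' hρ' hd => ?_⟩
  set σ : X → ℝ := fun x => ρ x + δ * (1 - ρ x)
  have hσ : σ ∈ C.P := C.convexCombo_mem_P hρ C.one_mem_P hδ.le hδ1
  have hmin : ∀ x, δ ≤ σ x := fun x => by
    simp only [σ]
    nlinarith [mul_nonneg (sub_nonneg.2 hδ1) (hρ.1 x)]
  have hρσ : ρ - σ = δ • (fun x => ρ x - 1 : X → ℝ) := by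
    ext x
    simp only [σ, Pi.sub_apply, Pi.smul_apply, smul_eq_mul]
    ring
  have hn : ‖ρ - σ‖ = δ * ‖(fun x => ρ x - 1 : X → ℝ)‖ := by
    rw [hρσ, norm_smul, Real.norm_of_nonneg hδ.le]
  have hn1 : ‖ρ - σ‖ ≤ δ * R := by
    rw [hn]
    simp only [R]
    linarith
  have hn2 : ‖ρ' - σ‖ ≤ δ * R := by
    calc ‖ρ' - σ‖ ≤ ‖ρ' - ρ‖ + ‖ρ - σ‖ := norm_sub_le_norm_sub_add_norm_sub _ _ _
      _ ≤ δ * R := by rw [hn]; simp only [R]; linarith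
  have key : ∀ μ ∈ C.P, ‖μ - σ‖ ≤ δ * R → (C.W θ μ σ).toReal ≤ √M * R * √δ := by
    intro μ hμ hμσ
    have h := ENNReal.toReal_mono ENNReal.ofReal_ne_top (hM μ hμ σ hσ δ hδ hmin)
    rw [ENNReal.toReal_pow, ENNReal.toReal_ofReal (by positivity)] at h
    refine le_of_sq_le_sq (h.trans ?_) (by positivity)
    rw [mul_pow, mul_pow, Real.sq_sqrt hM0, Real.sq_sqrt hδ.le]
    calc M * ‖μ - σ‖ ^ 2 / δ ≤ M * (δ * R) ^ 2 / δ := by gcongr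
      _ = M * R ^ 2 * δ := by field_simp
  have h := C.W_triangle θ (C.W_ne_top hθ hρ' hσ) (C.W_ne_top hθ hσ hρ)
  rw [C.W_symm θ σ ρ] at h
  linarith [key ρ hρ hn1, key ρ' hρ' hn2]

theorem continuousOn_W {θ : ℝ → ℝ → ℝ} (hθ : IsAdmissibleMean θ) {μ : X → ℝ} (hμ : μ ∈ C.P) :
    ContinuousOn (fun ρ => (C.W θ ρ μ).toReal) C.P := by
  intro ρ hρ
  obtain ⟨B, hB, h⟩ := C.exists_W_le_sqrt hθ hρ
  rw [Metric.continuousWithinAt_iff]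
  intro ε hε
  set δ := min 1 ((ε / (B + 1)) ^ 2)
  have hδ : 0 < δ := lt_min one_pos (by positivity)
  refine ⟨δ, hδ, fun ρ' hρ' hd => ?_⟩
  have h1 := h δ hδ (min_le_left _ _) ρ' hρ' (by rw [← dist_eq_norm]; exact hd.le)
  have h2 : √δ ≤ ε / (B + 1) := by
    rw [Real.sqrt_le_left (by positivity)]
    exact min_le_right _ _
  have h3 : B * √δ < ε := by
    calc B * √δ ≤ B * (ε / (B + 1)) := by gcongr
      _ < ε := by
        rw [mul_div_assoc', div_lt_iff₀ (by positivity)]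
        nlinarith
  have t1 := C.W_triangle θ (C.W_ne_top hθ hρ' hρ) (C.W_ne_top hθ hρ hμ)
  have t2 := C.W_triangle θ (C.W_ne_top hθ hρ hρ') (C.W_ne_top hθ hρ' hμ)
  rw [C.W_symm θ ρ ρ'] at t2
  rw [Real.dist_eq, abs_lt]
  constructor <;> linarith

theorem isCompact_P : IsCompact C.P := by
  have hbox := isCompact_univ_pi fun x => isCompact_Icc (a := (0 : ℝ)) (b := (C.π x)⁻¹)
  refine hbox.of_isClosed_subset ?_ fun ρ hρ x _ => ⟨hρ.1 x, ?_⟩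
  · have h : C.P = (⋂ x, {ρ | 0 ≤ ρ x}) ∩ {ρ | ∑ x, ρ x * C.π x = 1} := by
      ext ρ
      simp [P]
    rw [h]
    exact (isClosed_iInter fun x => isClosed_le continuous_const (continuous_apply x)).inter
      (isClosed_eq (by fun_prop) continuous_const)
  · rw [← one_div, le_div_iff₀ (C.π_pos x), ← hρ.2]
    exact Finset.single_le_sum (f := fun x => ρ x * C.π x)
      (fun y _ => mul_nonneg (hρ.1 y) (C.π_pos y).le) (Finset.mem_univ x)

end ReversibleChain

end DiscreteTransport

theorem mainTheorem1 {X : Type*} [Fintype X] (C : DiscreteTransport.ReversibleChain X)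
    (θ : ℝ → ℝ → ℝ) (hθ : DiscreteTransport.IsAdmissibleMean θ)
    (p : ℕ) (ν : Fin p → X → ℝ) (hν : ∀ i, ν i ∈ C.P)
    (w : Fin p → ℝ) (hw : w ∈ stdSimplex ℝ (Fin p)) :
    (∀ ρ ∈ C.P, ∀ ρ' ∈ C.P, C.W θ ρ ρ' ≠ ⊤) ∧
      ∃ νstar ∈ C.P, ∀ μ ∈ C.P, C.variance θ w ν νstar ≤ C.variance θ w ν μ := by
  refine ⟨fun ρ hρ ρ' hρ' => C.W_ne_top hθ hρ hρ', ?_⟩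
  have hcont : ContinuousOn (C.variance θ w ν) C.P :=
    continuousOn_finsetSum _ fun i _ =>
      continuousOn_const.mul ((C.continuousOn_W hθ (hν i)).pow 2)
  obtain ⟨μ, hμ, hmin⟩ := C.isCompact_P.exists_isMinOn ⟨_, C.one_mem_P⟩ hcont
  exact ⟨μ, hμ, fun σ hσ => hmin hσ⟩
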